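/- All vector spaces are complex. A Kreĭn space is a space $(\mathcal H,[\cdot,\cdot])$ with $[\xi,\eta]=\langle J\xi,\eta\rangle$ for some Hilbert space inner product $\langle\cdot,\cdot\rangle$ on $\mathcal H$ and some symmetry $J=J^*=J^{-1}$; topological notions refer to the Hilbert space topology (which does not depend on the choice of $J$). $\mathcal L(\mathcal H,\mathcal K)$ denotes the bounded linear operators, $\mathcal L(\mathcal H)=\mathcal L(\mathcal H,\mathcal H)$, and $T^\sharp$ is the adjoint of $T$ with respect to the indefinite inner products. Let $S$ be a unital semigroup with an involution $\mathfrak I$ (so $\mathfrak I(\mathfrak I(a))=a$, $\mathfrak I(ab)=\mathfrak I(b)\mathfrak I(a)$), let $\phi:S\times X\to X$ be an action of $S$ on a set $X$ (so $\phi(a,\phi(b,x))=\phi(ab,x)$ and $\phi(e,x)=x$ for the unit $e$), and let $\alpha:S\times X\to\mathbb C\setminus\{0\}$ satisfy $$\alpha(ab,x)\overline{\alpha(ab,y)}=\alpha(a,\phi(b,x))\overline{\alpha(a,\phi(b,y))}\,\alpha(b,x)\overline{\alpha(b,y)},\qquad \alpha(a\,\mathfrak I(a),x)=1$$ for all $a,b\in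 S$, $x,y\in X$. Then $\sigma(a,b)=\alpha(a,\phi(b,x))^{-1}\alpha(b,x)^{-1}\alpha(ab,x)$ does not depend on $x$ (if $X=\emptyset$, put $\sigma=1$). Let $\mathcal H$ be a Kreĭn space and $\mathcal F_0(X,\mathcal H)$ the space of finitely supported functions $X\to\mathcal H$. A kernel $K:X\times X\to\mathcal L(\mathcal H)$ is hermitian if $K(x,y)=K(y,x)^\sharp$ for all $x,y$; put $[f,g]_K=\sum_{x,y}[K(x,y)f(y),g(x)]$ for $f,g\in\mathcal F_0(X,\mathcal H)$. For hermitian kernels, $A\le B$ means $[f,f]_A\le[f,f]_B$ for all $f$, and $L$ is positive definite if $[f,f]_L\ge0$ for all $f$. Positive definite kernels $A,B$ are disjoint if $P=0$ is the only positive definite kernel with $P\le A$ and $P\le B$. For $a\in S$ let $\psi_a$ be the linear map on $\mathcal F_0(X,\mathcal H)$ that sends the function with value $\xi$ at $x$ and $0$ elsewhere to the function with value $\alpha(a,x)^{-1}\xi$ at $\phi(a,x)$ and $0$ elsewhere. A positive definite kernel $L$ is $\phi$-bounded if every $\psi_a$, $a\in S$, is bounded for the seminorm $f\mapsto[f,f]_L^{1/2}$;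 $\mathcal B_\phi^+(X,\mathcal H)$ is the set of positive definite $\phi$-bounded kernels. A hermitian kernel $K$ is $\phi$-invariant if $$K(x,\phi(a,y))=\overline{\alpha(a,\phi(\mathfrak I(a),x))}\,\alpha(a,y)\,K(\phi(\mathfrak I(a),x),y)\qquad(a\in S,\ x,y\in X).$$ A Kolmogorov decomposition of $K$ is a pair $(V;\mathcal K)$ of a Kreĭn space $\mathcal K$ and operators $V(x)\in\mathcal L(\mathcal H,\mathcal K)$, $x\in X$, with $K(x,y)=V(x)^\sharp V(y)$ for all $x,y$ and such that the linear span of $\bigcup_xV(x)\mathcal H$ is dense in $\mathcal K$. **Theorem.** Let $K$ be an $\mathcal L(\mathcal H)$-valued $\phi$-invariant hermitian kernel on $X$. The following assertions are equivalent: 1. There exists $L\in\mathcal B_\phi^+(X,\mathcal H)$ such that $-L\le K\le L$. 2. $K$ has a Kolmogorov decomposition $(V;\mathcal K)$ for which there exist operators $U(a)\in\mathcal L(\mathcal K)$, $a\in S$, such that $U(a)U(b)=\sigma(a,b)U(ab)$, $U(a)^\sharp=\overline{\sigma(\mathfrak I(a),a)}\,U(\mathfrak I(a))$ and $V(\phi(a,x))=\alpha(a,x)U(a)V(x)$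 for all $a,b\in S$, $x\in X$. 3. $K=K_1-K_2$ for two positive definite kernels $K_1,K_2$ such that $K_1+K_2\in\mathcal B_\phi^+(X,\mathcal H)$. 4. $K=K_+-K_-$ for two disjoint positive definite kernels $K_+,K_-$ such that $K_++K_-\in\mathcal B_\phi^+(X,\mathcal H)$. -/

import Mathlib

universe u v w

/-- A Kreĭn space: a complex Hilbert space `H`, whose norm is one of the (equivalent) unitary norms,
together with a fundamental symmetry `J = J* = J⁻¹`. The indefinite inner product is
`kreinInner`, that is `[ξ, η] = ⟨J ξ, η⟩`. -/
class KreinSpace (H : Type*) [NormedAddCommGroup H] [InnerProductSpace ℂ H] [CompleteSpace H] where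
  /-- the fundamental symmetry -/
  J : H →L[ℂ] H
  adjoint_J : ContinuousLinearMap.adjoint J = J
  J_comp_J : J ∘L J = ContinuousLinearMap.id ℂ H

section Krein

variable {H : Type*} [NormedAddCommGroup H] [InnerProductSpace ℂ H] [CompleteSpace H] [KreinSpace H]
variable {K : Type*} [NormedAddCommGroup K] [InnerProductSpace ℂ K] [CompleteSpace K] [KreinSpace K]

/-- The indefinite inner product `[ξ, η] = ⟨J ξ, η⟩`, linear in `ξ` and conjugate-linear in `η`
(Mathlib's `inner ℂ` is conjugate-linear in its first argument). -/
noncomputable def kreinInner (ξ η : H) : ℂ := inner ℂ η (KreinSpace.J ξ)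

/-- The adjoint `T♯` of `T` with respect to the indefinite inner products. -/
noncomputable def kreinAdjoint (T : H →L[ℂ] K) : K →L[ℂ] H :=
  KreinSpace.J ∘L ContinuousLinearMap.adjoint T ∘L KreinSpace.J

theorem kreinInner_conj (ξ η : H) : (starRingEnd ℂ) (kreinInner ξ η) = kreinInner η ξ := by
  unfold kreinInner
  rw [inner_conj_symm, ← ContinuousLinearMap.adjoint_inner_right, KreinSpace.adjoint_J]

/-- `kreinAdjoint T` is the adjoint of `T` for the indefinite inner products. -/
theorem kreinInner_apply_left (T : H →L[ℂ] K) (ξ : H) (η : K) :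
    kreinInner (T ξ) η = kreinInner ξ (kreinAdjoint T η) := by
  have h : ∀ u v : H, inner ℂ (KreinSpace.J u) (KreinSpace.J v) = (inner ℂ u v : ℂ) := by
    intro u v
    rw [← ContinuousLinearMap.adjoint_inner_right, KreinSpace.adjoint_J,
      ← ContinuousLinearMap.comp_apply, KreinSpace.J_comp_J, ContinuousLinearMap.id_apply]
  unfold kreinInner kreinAdjoint
  rw [ContinuousLinearMap.comp_apply, h, ContinuousLinearMap.comp_apply,
    ContinuousLinearMap.adjoint_inner_left, ← ContinuousLinearMap.adjoint_inner_left,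
    KreinSpace.adjoint_J]

end Krein

section Kernels

variable {X : Type*}
variable {H : Type*} [NormedAddCommGroup H] [InnerProductSpace ℂ H] [CompleteSpace H] [KreinSpace H]

/-- Hermitian kernels: `K(x, y) = K(y, x)♯`. -/
def IsHermitianKernel (K : X → X → H →L[ℂ] H) : Prop :=
  ∀ x y, K x y = kreinAdjoint (K y x)

/-- The inner product `[f, g]_K = ∑_{x, y} [K(x, y) f(y), g(x)]` on finitely supported functions. -/
noncomputable def kernelForm (K : X → X → H →L[ℂ] H) (f g : X →₀ H) : ℂ :=
  ∑ x ∈ g.support, ∑ y ∈ f.support, kreinInner (K x y (f y)) (g x)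

/-- For a hermitian kernel `[f, f]_K` is real; this is why real parts suffice below. -/
theorem kernelForm_self_im {K : X → X → H →L[ℂ] H} (hK : IsHermitianKernel K) (f : X →₀ H) :
    (kernelForm K f f).im = 0 := by
  rw [← Complex.conj_eq_iff_im]
  unfold kernelForm
  simp only [map_sum, kreinInner_conj]
  rw [Finset.sum_comm]
  refine Finset.sum_congr rfl fun x _ => Finset.sum_congr rfl fun y _ => ?_
  rw [hK x y, ← kreinInner_conj, kreinInner_apply_left, kreinInner_conj]

/-- Positive definite (hermitian) kernels: `[f, f]_L ≥ 0` for all `f`. -/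
def IsPosDefKernel (L : X → X → H →L[ℂ] H) : Prop :=
  IsHermitianKernel L ∧ ∀ f : X →₀ H, 0 ≤ (kernelForm L f f).re

/-- The order of hermitian kernels: `[f, f]_A ≤ [f, f]_B` for all `f`. -/
def KernelLE (A B : X → X → H →L[ℂ] H) : Prop :=
  ∀ f : X →₀ H, (kernelForm A f f).re ≤ (kernelForm B f f).re

/-- Disjointness of positive definite kernels. -/
def DisjointKernels (A B : X → X → H →L[ℂ] H) : Prop :=
  ∀ P : X → X → H →L[ℂ] H, IsPosDefKernel P → KernelLE P A → KernelLE P B → P = 0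

/-- The seminorm `[f, f]_L^{1/2}` of a positive definite kernel `L`. -/
noncomputable def kernelSeminorm (L : X → X → H →L[ℂ] H) (f : X →₀ H) : ℝ :=
  Real.sqrt (kernelForm L f f).re

/-- Kolmogorov decompositions `(V; 𝒦)` of `K`: `K(x, y) = V(x)♯ V(y)`, and the linear span of the
ranges of all `V(x)` is dense in `𝒦`. -/
def IsKolmogorovDecomposition {𝒦 : Type*} [NormedAddCommGroup 𝒦] [InnerProductSpace ℂ 𝒦]
    [CompleteSpace 𝒦] [KreinSpace 𝒦] (K : X → X → H →L[ℂ] H) (V : X → H →L[ℂ] 𝒦) : Prop :=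
  (∀ x y, K x y = kreinAdjoint (V x) ∘L V y) ∧
    Dense (Submodule.span ℂ (⋃ x, Set.range (V x)) : Set 𝒦)

end Kernels

/-- The linear map `ψ_a` on finitely supported functions with
`ψ_a(ξ_x) = (α(a, x)⁻¹ ξ)_{φ(a, x)}`, where `ξ_x = Finsupp.single x ξ`. -/
noncomputable def kernelShift {S X E : Type*} [Monoid S] [MulAction S X]
    [NormedAddCommGroup E] [InnerProductSpace ℂ E] (α : S → X → ℂ) (a : S) : (X →₀ E) →ₗ[ℂ] (X →₀ E) :=
  Finsupp.lsum ℂ fun x => (α a x)⁻¹ • Finsupp.lsingle (a • x)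

theorem kernelShift_single {S X E : Type*} [Monoid S] [MulAction S X]
    [NormedAddCommGroup E] [InnerProductSpace ℂ E] (α : S → X → ℂ) (a : S) (x : X) (ξ : E) :
    kernelShift α a (Finsupp.single x ξ) = Finsupp.single (a • x) ((α a x)⁻¹ • ξ) := by
  simp [kernelShift]

section Invariance

variable {S : Type*} [Monoid S] {X : Type*} [MulAction S X]
variable {H : Type*} [NormedAddCommGroup H] [InnerProductSpace ℂ H] [CompleteSpace H] [KreinSpace H]

/-- The standing assumptions on `α : S × X → ℂ`; the action is `φ(a, x) = a • x`. -/
structure IsMultiplier (α : S → X → ℂ) : Prop where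
  ne_zero : ∀ a x, α a x ≠ 0
  mul_conj : ∀ (a b : S) (x y : X),
    α (a * b) x * (starRingEnd ℂ) (α (a * b) y) =
      α a (b • x) * (starRingEnd ℂ) (α a (b • y)) * (α b x * (starRingEnd ℂ) (α b y))

open Classical in
/-- `σ(a, b) = α(a, φ(b, x))⁻¹ α(b, x)⁻¹ α(ab, x)`, which does not depend on `x`
(see `multiplierCocycle_eq`); the value for empty `X` is immaterial. -/
noncomputable def multiplierCocycle (α : S → X → ℂ) (a b : S) : ℂ :=
  if h : Nonempty X then (α a (b • h.some))⁻¹ * (α b h.some)⁻¹ * α (a * b) h.some else 1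

theorem multiplierCocycle_eq {α : S → X → ℂ} (hα : IsMultiplier α) (a b : S) (x : X) :
    multiplierCocycle α a b = (α a (b • x))⁻¹ * (α b x)⁻¹ * α (a * b) x := by
  have h : Nonempty X := ⟨x⟩
  unfold multiplierCocycle
  rw [dif_pos h]
  generalize h.some = y
  have h1 := hα.mul_conj a b y x
  have h2 := hα.mul_conj a b x x
  have n1 := hα.ne_zero a (b • y)
  have n2 := hα.ne_zero b y
  have n3 := hα.ne_zero a (b • x)
  have n4 := hα.ne_zero b x
  have n5 : (starRingEnd ℂ) (α (a * b) x) ≠ 0 := by simpa using hα.ne_zero (a * b) x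
  field_simp
  apply mul_right_cancel₀ n5
  linear_combination (α a (b • x) * α b x) * h1 - (α a (b • y) * α b y) * h2

/-- `L ∈ 𝓑_φ⁺(X, H)`: `L` is positive definite, and every `ψ_a` is bounded for the seminorm
`[·, ·]_L^{1/2}`. -/
def IsPhiBoundedPosDef (α : S → X → ℂ) (L : X → X → H →L[ℂ] H) : Prop :=
  IsPosDefKernel L ∧ ∀ a : S, ∃ C : ℝ, 0 ≤ C ∧ ∀ f : X →₀ H,
    kernelSeminorm L (kernelShift α a f) ≤ C * kernelSeminorm L f

/-- `φ`-invariant kernels; the involution of `S` is `star`. -/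
def IsPhiInvariant [StarMul S] (α : S → X → ℂ) (K : X → X → H →L[ℂ] H) : Prop :=
  ∀ (a : S) (x y : X),
    K x (a • y) = ((starRingEnd ℂ) (α a (star a • x)) * α a y) • K (star a • x) y

/-- Symmetric projective representations `U` of `S` by bounded operators on a Kreĭn space:
`U(a) U(b) = σ(a, b) U(ab)` and `U(a)♯ = conj σ(a*, a) U(a*)`, with `a*` the involution. -/
structure IsSymmProjRep [StarMul S] {𝒦 : Type*} [NormedAddCommGroup 𝒦] [InnerProductSpace ℂ 𝒦]
    [CompleteSpace 𝒦] [KreinSpace 𝒦] (α : S → X → ℂ) (U : S → 𝒦 →L[ℂ] 𝒦) : Prop where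
  map_mul : ∀ a b, U a ∘L U b = multiplierCocycle α a b • U (a * b)
  symm : ∀ a, (starRingEnd ℂ) (multiplierCocycle α (star a) a) • U (star a) = kreinAdjoint (U a)

end Invariance

/-! ### Operator inequalities and the factorization of selfadjoint operators -/

section Operators

variable {G : Type*} [NormedAddCommGroup G] [InnerProductSpace ℂ G] [CompleteSpace G]

/-! Suppose `-L ≤ K ≤ L`. Completing the finitely supported functions in the form of `L` gives a
Hilbert space `G`, on which `K` becomes the form of a selfadjoint operator `A`
(`exists_gram_operator`). Splitting `A` into modulus and sign gives a Kreĭn space whose symmetry is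
the sign of `A` (`exists_induced_kreinSpace`); it carries the Kolmogorov decomposition. Since `L` is
`φ`-bounded, each `ψ_a` extends to a bounded operator `T a` on `G`, and invariance of `K` says that
`A * T a = S* A`, where `S` is a scalar multiple of `T (star a)` (`kernelForm_kernelShift`).

The difficulty is that `T a` has to be bounded for the seminorm `‖|A|^{1/2} x‖` of the Kreĭn space,
which is weaker than the norm of `G`. The intertwining relation forces this
(`exists_bound_of_intertwining`): it bounds `‖T* |A| T x‖` by a multiple of `‖|A| x‖`, and
monotonicity of the operator square root turns this norm bound into a bound of quadratic forms.

Conversely, a Kolmogorov decomposition `V` with symmetry `J` splits `K` along the projections `(1 ±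
J)/2`. The two parts add up to the Hilbert space Gram kernel of `V`, which is `φ`-bounded because `U
a` is bounded. They are disjoint because a positive form below both vanishes on both ranges
(`disjointKernels_operatorKernel`). Finally, if `K = K₁ - K₂`, then `L = K₁ + K₂` dominates `K`. -/

/-- Monotonicity of the operator square root, stated for norms and quadratic forms. -/
theorem re_inner_le_of_norm_apply_le {M N : G →L[ℂ] G} (hM : 0 ≤ M) (hN : 0 ≤ N)
    (h : ∀ x, ‖M x‖ ≤ ‖N x‖) (x : G) :
    (inner ℂ x (M x) : ℂ).re ≤ (inner ℂ x (N x) : ℂ).re := by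
  have hMs : ContinuousLinearMap.adjoint M = M := (IsSelfAdjoint.of_nonneg hM).star_eq
  have hNs : ContinuousLinearMap.adjoint N = N := (IsSelfAdjoint.of_nonneg hN).star_eq
  -- The norm hypothesis is exactly this inequality, since `⟨M² y, y⟩ = ‖M y‖²`; taking square roots
  -- then preserves the order.
  have hsq : M * M ≤ N * N := by
    rw [ContinuousLinearMap.le_def, ContinuousLinearMap.isPositive_def']
    refine ⟨?_, fun y => ?_⟩
    · exact ((IsSelfAdjoint.of_nonneg hN).mul_self_nonneg |> IsSelfAdjoint.of_nonneg).sub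
        ((IsSelfAdjoint.of_nonneg hM).mul_self_nonneg |> IsSelfAdjoint.of_nonneg)
    · have e : ∀ T : G →L[ℂ] G, ContinuousLinearMap.adjoint T = T →
          (inner ℂ (T (T y)) y : ℂ).re = ‖T y‖ ^ 2 := by
        intro T hT
        rw [← ContinuousLinearMap.adjoint_inner_right, hT]
        exact inner_self_eq_norm_sq (𝕜 := ℂ) (T y)
      rw [ContinuousLinearMap.reApplyInnerSelf_apply]
      simp only [sub_apply, mul_apply_eq_comp, inner_sub_left]
      simp only [map_sub, RCLike.re_eq_complex_re, e M hMs, e N hNs, sub_nonneg]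
      gcongr
      exact h y
  have hle : M ≤ N := by
    have := CFC.sqrt_le_sqrt _ _ hsq
    rwa [CFC.sqrt_mul_self M hM, CFC.sqrt_mul_self N hN] at this
  have := ((ContinuousLinearMap.le_def _ _).1 hle).re_inner_nonneg_right x
  simp only [sub_apply, inner_sub_right, map_sub, RCLike.re_eq_complex_re] at this
  linarith

/-- A selfadjoint operator factors as `A = R Q = Q R` with `R`, `Q` selfadjoint and
`R² = Q² = |A|`. -/
theorem exists_symmetric_factorization {A : G →L[ℂ] G} (hA : IsSelfAdjoint A) :
    ∃ R Q : G →L[ℂ] G, IsSelfAdjoint R ∧ IsSelfAdjoint Q ∧ R * Q = A ∧ Q * R = A ∧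
      Q * Q = R * R := by
  -- As `Real.sqrt` vanishes on negative numbers, `√x - √(-x)` is `sgn(x) √|x|`. Thus `R =
  -- |A|^{1/2}` and `Q = sgn(A) |A|^{1/2}`, both continuous functions of `A`, whereas the sign
  -- itself is not.
  have key : ∀ x : ℝ, √|x| * (√x - √(-x)) = x := by
    intro x
    rcases le_total 0 x with h | h
    · rw [abs_of_nonneg h, Real.sqrt_eq_zero_of_nonpos (neg_nonpos.2 h), sub_zero,
        Real.mul_self_sqrt h]
    · rw [abs_of_nonpos h, Real.sqrt_eq_zero_of_nonpos h, zero_sub, mul_neg,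
        Real.mul_self_sqrt (neg_nonneg.2 h), neg_neg]
  have key2 : ∀ x : ℝ, (√x - √(-x)) * (√x - √(-x)) = √|x| * √|x| := by
    intro x
    rcases le_total 0 x with h | h
    · simp [abs_of_nonneg h, Real.sqrt_eq_zero_of_nonpos (neg_nonpos.2 h)]
    · simp [abs_of_nonpos h, Real.sqrt_eq_zero_of_nonpos h]
  have hid : cfc (fun x : ℝ => x) A = A := cfc_id' ℝ A
  refine ⟨cfc (fun x : ℝ => √|x|) A, cfc (fun x : ℝ => √x - √(-x)) A, cfc_predicate _ A,
    cfc_predicate _ A, ?_, ?_, ?_⟩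
  · rw [← cfc_mul _ _ A (by fun_prop) (by fun_prop)]
    simp only [key, hid]
  · rw [← cfc_mul _ _ A (by fun_prop) (by fun_prop)]
    simp only [mul_comm _ √|_|, key, hid]
  · rw [← cfc_mul _ _ A (by fun_prop) (by fun_prop), ← cfc_mul _ _ A (by fun_prop) (by fun_prop)]
    simp only [key2]

/-- If `A = R Q = Q R` with `R² = Q²` and `A T = S* A`, then `T` is bounded for the
seminorm `‖R ·‖`. -/
theorem exists_bound_of_intertwining {A R Q T S : G →L[ℂ] G} (hR : IsSelfAdjoint R)
    (hQ : IsSelfAdjoint Q) (hQR : Q * R = A) (hsq : Q * Q = R * R)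
    (hTS : A * T = ContinuousLinearMap.adjoint S * A) :
    ∃ C : ℝ, ∀ x, ‖R (T x)‖ ≤ C * ‖R x‖ := by
  have hR' : ContinuousLinearMap.adjoint R = R := hR.star_eq
  have hQ' : ContinuousLinearMap.adjoint Q = Q := hQ.star_eq
  have nQ : ∀ x, ‖Q x‖ = ‖R x‖ := by
    intro x
    have h1 : (inner ℂ (Q x) (Q x) : ℂ) = inner ℂ (R x) (R x) := by
      rw [← ContinuousLinearMap.adjoint_inner_right, ← ContinuousLinearMap.adjoint_inner_right,
        hR', hQ', ← mul_apply_eq_comp, hsq, mul_apply_eq_comp]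
    rw [← sq_eq_sq₀ (norm_nonneg _) (norm_nonneg _)]
    simpa [inner_self_eq_norm_sq_to_K, ← Complex.ofReal_pow] using h1
  have nA : ∀ x, ‖A x‖ = ‖R (R x)‖ := by
    intro x
    rw [← hQR, mul_apply_eq_comp, nQ]
  have hRR : 0 ≤ R * R := hR.mul_self_nonneg
  set c : ℝ := ‖T‖ * ‖S‖ with hc
  have hc0 : 0 ≤ c := by positivity
  have hN : 0 ≤ (c : ℂ) • (R * R) := by
    have : (c : ℂ) • (R * R) = c • (R * R) := by ext x; simp
    rw [this]
    exact smul_nonneg hc0 hRR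
  have hM : 0 ≤ star T * (R * R) * T := star_left_conjugate_nonneg hRR T
  -- Here `‖R² y‖ = ‖A y‖`, so `A T = S* A` moves `T` to the left of `A`. The resulting norm bound
  -- upgrades to `T* R² T ≤ c R²` as forms, and this is the claim squared.
  have hle := re_inner_le_of_norm_apply_le hM hN fun x => by
    simp only [mul_apply_eq_comp, smul_apply, norm_smul,
      Complex.norm_real, Real.norm_of_nonneg hc0]
    calc ‖star T (R (R (T x)))‖ ≤ ‖star T‖ * ‖R (R (T x))‖ := ContinuousLinearMap.le_opNorm _ _
      _ = ‖T‖ * ‖(A * T) x‖ := by rw [norm_star, mul_apply_eq_comp, nA]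
      _ ≤ ‖T‖ * (‖S‖ * ‖A x‖) := by
          rw [hTS, mul_apply_eq_comp,
            ← (ContinuousLinearMap.adjoint (𝕜 := ℂ) (E := G) (F := G)).norm_map S]
          gcongr
          exact ContinuousLinearMap.le_opNorm _ _
      _ = c * ‖R (R x)‖ := by rw [nA, hc]; ring
  refine ⟨√c, fun x => ?_⟩
  refine le_of_sq_le_sq ?_ (by positivity)
  rw [mul_pow, Real.sq_sqrt hc0]
  have e : ∀ y, (inner ℂ y (R (R y)) : ℂ).re = ‖R y‖ ^ 2 := by
    intro y
    rw [← ContinuousLinearMap.adjoint_inner_left, hR']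
    exact inner_self_eq_norm_sq (𝕜 := ℂ) (R y)
  have := hle x
  simp only [mul_apply_eq_comp, smul_apply, inner_smul_right,
    ContinuousLinearMap.star_eq_adjoint, ContinuousLinearMap.adjoint_inner_right,
    Complex.re_ofReal_mul, e] at this
  simpa [e] using this

end Operators

/-! ### Elementary rules for the indefinite inner product -/

section KreinBasics

variable {H : Type*} [NormedAddCommGroup H] [InnerProductSpace ℂ H] [CompleteSpace H]
  [KreinSpace H]

theorem KreinSpace.J_J_apply (ξ : H) : (KreinSpace.J (KreinSpace.J ξ : H) : H) = ξ := by
  rw [← ContinuousLinearMap.comp_apply, KreinSpace.J_comp_J, ContinuousLinearMap.id_apply]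

theorem eq_of_kreinInner_right {ξ ζ : H} (h : ∀ η, kreinInner ξ η = kreinInner ζ η) : ξ = ζ := by
  have : (KreinSpace.J ξ : H) = KreinSpace.J ζ := ext_inner_left ℂ h
  rw [← KreinSpace.J_J_apply ξ, this, KreinSpace.J_J_apply]

theorem kreinInner_add_left (ξ ζ η : H) :
    kreinInner (ξ + ζ) η = kreinInner ξ η + kreinInner ζ η := by
  simp [kreinInner]

theorem kreinInner_sub_left (ξ ζ η : H) :
    kreinInner (ξ - ζ) η = kreinInner ξ η - kreinInner ζ η := by
  simp [kreinInner]

theorem kreinInner_smul_left (c : ℂ) (ξ η : H) :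
    kreinInner (c • ξ) η = c * kreinInner ξ η := by
  simp [kreinInner]

theorem kreinInner_add_right (ξ η ζ : H) :
    kreinInner ξ (η + ζ) = kreinInner ξ η + kreinInner ξ ζ := by
  simp [kreinInner]

theorem kreinInner_smul_right (c : ℂ) (ξ η : H) :
    kreinInner ξ (c • η) = (starRingEnd ℂ) c * kreinInner ξ η := by
  rw [kreinInner, kreinInner, inner_smul_left]

theorem kreinInner_zero_left (η : H) : kreinInner 0 η = 0 := by simp [kreinInner]

theorem kreinInner_zero_right (ξ : H) : kreinInner ξ 0 = 0 := by simp [kreinInner]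

end KreinBasics

/-! ### Sesquilinearity of kernel forms -/

section KernelForm

variable {X : Type*}
variable {H : Type*} [NormedAddCommGroup H] [InnerProductSpace ℂ H] [CompleteSpace H]
  [KreinSpace H]

theorem isHermitianKernel_iff {K : X → X → H →L[ℂ] H} :
    IsHermitianKernel K ↔
      ∀ x y ξ η, (starRingEnd ℂ) (kreinInner (K y x η) ξ) = kreinInner (K x y ξ) η := by
  refine ⟨fun h x y ξ η => ?_, fun h x y => ?_⟩
  · rw [h x y, ← kreinInner_conj η, ← kreinInner_apply_left]
  · ext ξ
    refine eq_of_kreinInner_right fun η => ?_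
    rw [← h, kreinInner_apply_left, kreinInner_conj]

theorem kernel_ext {A B : X → X → H →L[ℂ] H}
    (h : ∀ x y ξ η, kreinInner (A x y ξ) η = kreinInner (B x y ξ) η) : A = B := by
  funext x y
  ext ξ
  exact eq_of_kreinInner_right (h x y ξ)

theorem kernelForm_eq_sum (K : X → X → H →L[ℂ] H) (f g : X →₀ H) :
    kernelForm K f g = g.sum fun x η => f.sum fun y ξ => kreinInner (K x y ξ) η := rfl

theorem kernelForm_single (K : X → X → H →L[ℂ] H) (x y : X) (ξ η : H) :
    kernelForm K (Finsupp.single y ξ) (Finsupp.single x η) = kreinInner (K x y ξ) η := by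
  rw [kernelForm_eq_sum, Finsupp.sum_single_index, Finsupp.sum_single_index]
  · simp [kreinInner_zero_left]
  · simp [kreinInner_zero_right]

theorem kernelForm_add_left (K : X → X → H →L[ℂ] H) (f₁ f₂ g : X →₀ H) :
    kernelForm K (f₁ + f₂) g = kernelForm K f₁ g + kernelForm K f₂ g := by
  classical
  simp only [kernelForm_eq_sum, ← Finsupp.sum_add]
  refine Finsupp.sum_congr fun x _ => Finsupp.sum_add_index' ?_ ?_
  · simp [kreinInner_zero_left]
  · simp [kreinInner_add_left]

theorem kernelForm_add_right (K : X → X → H →L[ℂ] H) (f g₁ g₂ : X →₀ H) :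
    kernelForm K f (g₁ + g₂) = kernelForm K f g₁ + kernelForm K f g₂ := by
  classical
  simp only [kernelForm_eq_sum]
  refine Finsupp.sum_add_index' ?_ ?_
  · simp [kreinInner_zero_right]
  · simp [kreinInner_add_right, Finsupp.sum_add]

theorem kernelForm_zero_left (K : X → X → H →L[ℂ] H) (g : X →₀ H) : kernelForm K 0 g = 0 := by
  simp [kernelForm]

theorem kernelForm_zero_right (K : X → X → H →L[ℂ] H) (f : X →₀ H) : kernelForm K f 0 = 0 := by
  simp [kernelForm]

theorem kernelForm_smul_left (K : X → X → H →L[ℂ] H) (c : ℂ) (f g : X →₀ H) :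
    kernelForm K (c • f) g = c * kernelForm K f g := by
  induction f using Finsupp.induction_linear with
  | zero => simp [kernelForm_zero_left]
  | add f₁ f₂ h₁ h₂ => rw [smul_add, kernelForm_add_left, h₁, h₂, kernelForm_add_left, mul_add]
  | single y ξ =>
    induction g using Finsupp.induction_linear with
    | zero => simp [kernelForm_zero_right]
    | add g₁ g₂ h₁ h₂ => rw [kernelForm_add_right, h₁, h₂, kernelForm_add_right, mul_add]
    | single x η =>
      rw [Finsupp.smul_single, kernelForm_single, kernelForm_single, map_smul,
        kreinInner_smul_left]

theorem kernelForm_conj {K : X → X → H →L[ℂ] H} (hK : IsHermitianKernel K) (f g : X →₀ H) :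
    (starRingEnd ℂ) (kernelForm K f g) = kernelForm K g f := by
  unfold kernelForm
  simp only [map_sum]
  rw [Finset.sum_comm]
  exact Finset.sum_congr rfl fun x _ => Finset.sum_congr rfl fun y _ =>
    isHermitianKernel_iff.1 hK _ _ _ _

theorem kernelForm_add (A B : X → X → H →L[ℂ] H) (f g : X →₀ H) :
    kernelForm (A + B) f g = kernelForm A f g + kernelForm B f g := by
  simp [kernelForm, kreinInner_add_left, Finset.sum_add_distrib]

theorem kernelForm_neg (A : X → X → H →L[ℂ] H) (f g : X →₀ H) :
    kernelForm (-A) f g = -kernelForm A f g := by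
  simp [kernelForm, kreinInner]

/-- A kernel form is determined by its values on functions supported at one point. -/
theorem kernelForm_eq_inner {G : Type*} [NormedAddCommGroup G] [InnerProductSpace ℂ G]
    {K : X → X → H →L[ℂ] H} (v w : (X →₀ H) →ₗ[ℂ] G)
    (h : ∀ x y ξ η,
      kreinInner (K x y ξ) η = inner ℂ (w (Finsupp.single x η)) (v (Finsupp.single y ξ)))
    (f g : X →₀ H) : kernelForm K f g = inner ℂ (w g) (v f) := by
  induction f using Finsupp.induction_linear with
  | zero => simp [kernelForm_zero_left]
  | add f₁ f₂ h₁ h₂ => rw [kernelForm_add_left, h₁, h₂, map_add, inner_add_right]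
  | single y ξ =>
    induction g using Finsupp.induction_linear with
    | zero => simp [kernelForm_zero_right]
    | add g₁ g₂ h₁ h₂ => rw [kernelForm_add_right, h₁, h₂, map_add, inner_add_left]
    | single x η => rw [kernelForm_single, h]

end KernelForm

/-! ### The Hilbert space of a positive definite kernel -/

section Realization

variable {X : Type u}
variable {H : Type v} [NormedAddCommGroup H] [InnerProductSpace ℂ H] [CompleteSpace H]
  [KreinSpace H]

/-- The form of a positive definite kernel, as a semidefinite inner product. -/
@[reducible]
noncomputable def IsPosDefKernel.core {L : X → X → H →L[ℂ] H} (hL : IsPosDefKernel L) :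
    PreInnerProductSpace.Core ℂ (X →₀ H) where
  inner g f := kernelForm L f g
  conj_inner_symm f g := kernelForm_conj hL.1 f g
  re_inner_nonneg f := hL.2 f
  add_left g₁ g₂ f := kernelForm_add_right L f g₁ g₂
  smul_left g f c := by
    rw [← kernelForm_conj hL.1, kernelForm_smul_left, map_mul, kernelForm_conj hL.1]

/-- The Hilbert space of a positive definite kernel: the completion of the finitely supported
functions in the form of the kernel. -/
theorem IsPosDefKernel.exists_realization {L : X → X → H →L[ℂ] H} (hL : IsPosDefKernel L) :
    ∃ (G : Type (max u v)) (_ : NormedAddCommGroup G) (_ : InnerProductSpace ℂ G)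
      (_ : CompleteSpace G) (q : (X →₀ H) →ₗ[ℂ] G), DenseRange q ∧
        ∀ f g, kernelForm L f g = inner ℂ (q g) (q f) := by
  let c := hL.core
  let i₁ : SeminormedAddCommGroup (X →₀ H) :=
    InnerProductSpace.Core.toSeminormedAddCommGroup (𝕜 := ℂ)
  let i₂ : InnerProductSpace ℂ (X →₀ H) := InnerProductSpace.ofCore c
  refine ⟨UniformSpace.Completion (X →₀ H), inferInstance, inferInstance, inferInstance,
    (UniformSpace.Completion.toComplL (𝕜 := ℂ) (E := X →₀ H)).toLinearMap,
    UniformSpace.Completion.denseRange_coe, fun f g => ?_⟩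
  exact (UniformSpace.Completion.inner_coe (𝕜 := ℂ) g f).symm

theorem kernelForm_self_re_eq_norm_sq {G : Type*} [NormedAddCommGroup G] [InnerProductSpace ℂ G]
    {L : X → X → H →L[ℂ] H} {q : (X →₀ H) →ₗ[ℂ] G}
    (h : ∀ f g, kernelForm L f g = inner ℂ (q g) (q f)) (f : X →₀ H) :
    (kernelForm L f f).re = ‖q f‖ ^ 2 := by
  rw [h]
  exact inner_self_eq_norm_sq (𝕜 := ℂ) (q f)

theorem kernelSeminorm_eq_norm {G : Type*} [NormedAddCommGroup G] [InnerProductSpace ℂ G]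
    {L : X → X → H →L[ℂ] H} {q : (X →₀ H) →ₗ[ℂ] G}
    (h : ∀ f g, kernelForm L f g = inner ℂ (q g) (q f)) (f : X →₀ H) :
    kernelSeminorm L f = ‖q f‖ := by
  rw [kernelSeminorm, kernelForm_self_re_eq_norm_sq h, Real.sqrt_sq (norm_nonneg _)]

end Realization

/-! ### Synthesis maps -/

section Synthesis

variable {X : Type*}
variable {H : Type*} [NormedAddCommGroup H] [InnerProductSpace ℂ H]
variable {G : Type*} [NormedAddCommGroup G] [InnerProductSpace ℂ G]

/-- The linear map `f ↦ ∑ V(x) f(x)`. -/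
noncomputable def synthesis (V : X → H →L[ℂ] G) : (X →₀ H) →ₗ[ℂ] G :=
  Finsupp.lsum ℂ fun x => (V x).toLinearMap

@[simp]
theorem synthesis_single (V : X → H →L[ℂ] G) (x : X) (ξ : H) :
    synthesis V (Finsupp.single x ξ) = V x ξ := by
  simp [synthesis]

theorem range_synthesis (V : X → H →L[ℂ] G) :
    LinearMap.range (synthesis V) = Submodule.span ℂ (⋃ x, Set.range (V x)) := by
  refine le_antisymm ?_ (Submodule.span_le.2 ?_)
  · rintro _ ⟨f, rfl⟩
    induction f using Finsupp.induction_linear with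
    | zero => simp
    | add f g hf hg => rw [map_add]; exact add_mem hf hg
    | single x ξ =>
      rw [synthesis_single]
      exact Submodule.subset_span (Set.mem_iUnion.2 ⟨x, ξ, rfl⟩)
  · rintro _ hz
    obtain ⟨x, ξ, rfl⟩ := Set.mem_iUnion.1 hz
    exact ⟨Finsupp.single x ξ, synthesis_single V x ξ⟩

theorem dense_span_iff_denseRange_synthesis (V : X → H →L[ℂ] G) :
    Dense (Submodule.span ℂ (⋃ x, Set.range (V x)) : Set G) ↔ DenseRange (synthesis V) := by
  rw [← range_synthesis, LinearMap.coe_range, DenseRange]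

end Synthesis

/-! ### Kernels defined by operators -/

section OperatorKernel

variable {X : Type*}
variable {H : Type*} [NormedAddCommGroup H] [InnerProductSpace ℂ H] [CompleteSpace H]
  [KreinSpace H]
variable {G : Type*} [NormedAddCommGroup G] [InnerProductSpace ℂ G] [CompleteSpace G]

/-- The kernel `(x, y) ↦ V(x)* B V(y)`, with the adjoint taken from a Hilbert space to a
Kreĭn space. -/
noncomputable def operatorKernel (V : X → H →L[ℂ] G) (B : G →L[ℂ] G) : X → X → H →L[ℂ] H :=
  fun x y => KreinSpace.J ∘L ContinuousLinearMap.adjoint (V x) ∘L B ∘L V y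

theorem kreinInner_operatorKernel (V : X → H →L[ℂ] G) (B : G →L[ℂ] G) (x y : X) (ξ η : H) :
    kreinInner (operatorKernel V B x y ξ) η = inner ℂ (V x η) (B (V y ξ)) := by
  simp only [kreinInner, operatorKernel, ContinuousLinearMap.comp_apply, KreinSpace.J_J_apply,
    ContinuousLinearMap.adjoint_inner_right]

theorem kernelForm_operatorKernel (V : X → H →L[ℂ] G) (B : G →L[ℂ] G) (f g : X →₀ H) :
    kernelForm (operatorKernel V B) f g = inner ℂ (synthesis V g) (B (synthesis V f)) :=
  kernelForm_eq_inner (B.toLinearMap ∘ₗ synthesis V) (synthesis V)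
    (fun x y ξ η => by simp [kreinInner_operatorKernel]) f g

theorem isPosDefKernel_operatorKernel (V : X → H →L[ℂ] G) {B : G →L[ℂ] G} (hB : B.IsPositive) :
    IsPosDefKernel (operatorKernel V B) := by
  refine ⟨isHermitianKernel_iff.2 fun x y ξ η => ?_, fun f => ?_⟩
  · rw [kreinInner_operatorKernel, kreinInner_operatorKernel, inner_conj_symm,
      hB.inner_left_eq_inner_right]
  · rw [kernelForm_operatorKernel]
    exact hB.re_inner_nonneg_right _

end OperatorKernel

/-! ### The shifts `ψ_a` and invariance -/

section Shift

variable {S : Type*} [Monoid S] {X : Type*} [MulAction S X]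

theorem kernelShift_comp {H : Type*} [NormedAddCommGroup H] [InnerProductSpace ℂ H]
    {α : S → X → ℂ} (hα : IsMultiplier α) (a b : S) (f : X →₀ H) :
    kernelShift α a (kernelShift α b f) = multiplierCocycle α a b • kernelShift α (a * b) f := by
  induction f using Finsupp.induction_linear with
  | zero => simp
  | add f g hf hg => simp only [map_add, hf, hg, smul_add]
  | single x ξ =>
    have n1 := hα.ne_zero (a * b) x
    have e : (α a (b • x))⁻¹ * (α b x)⁻¹ = multiplierCocycle α a b * (α (a * b) x)⁻¹ := by
      rw [multiplierCocycle_eq hα a b x]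
      field_simp
    simp only [kernelShift_single, Finsupp.smul_single, smul_smul, e]

variable {H : Type*} [NormedAddCommGroup H] [InnerProductSpace ℂ H] [CompleteSpace H]
  [KreinSpace H]

/-- This is the invariance of `K` in operator form, and the source of both the intertwining relation
and the formula for `U(a)♯`. For functions supported at one point, both sides are multiples of the
same value of the form, and the scalars agree because `α(a* a, x) = 1`. -/
theorem kernelForm_kernelShift [StarMul S] {α : S → X → ℂ} (hα : IsMultiplier α)
    (hα_star : ∀ (a : S) (x : X), α (a * star a) x = 1) {K : X → X → H →L[ℂ] H}
    (hK : IsHermitianKernel K) (hK_inv : IsPhiInvariant α K) (a : S) (f g : X →₀ H) :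
    kernelForm K (kernelShift α a f) g =
      multiplierCocycle α (star a) a * kernelForm K f (kernelShift α (star a) g) := by
  induction f using Finsupp.induction_linear with
  | zero => simp [kernelForm_zero_left]
  | add f₁ f₂ h₁ h₂ => simp only [map_add, kernelForm_add_left, h₁, h₂, mul_add]
  | single x ξ =>
    induction g using Finsupp.induction_linear with
    | zero => simp [kernelForm_zero_right]
    | add g₁ g₂ h₁ h₂ => simp only [map_add, kernelForm_add_right, h₁, h₂, mul_add]
    | single y η =>
      have e : α (star a * a) x = 1 := by simpa using hα_star (star a) x
      have n1 := hα.ne_zero a x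
      have n2 := hα.ne_zero (star a) (a • x)
      have n3 : (starRingEnd ℂ) (α (star a) y) ≠ 0 := by simpa using hα.ne_zero (star a) y
      rw [kernelShift_single, kernelShift_single, kernelForm_single, kernelForm_single, map_smul,
        kreinInner_smul_left, kreinInner_smul_right, ← isHermitianKernel_iff.1 hK y (a • x),
        ← isHermitianKernel_iff.1 hK (star a • y) x, hK_inv (star a) x y, star_star,
        multiplierCocycle_eq hα (star a) a x, e, smul_apply, kreinInner_smul_left]
      simp only [map_mul, map_inv₀, Complex.conj_conj]
      field_simp

end Shift

/-! ### Identities checked on a dense range -/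

section Density

theorem ext_inner_of_denseRange {ι G : Type*} [NormedAddCommGroup G] [InnerProductSpace ℂ G]
    {r : ι → G} (hr : DenseRange r) {a b : G}
    (h : ∀ i, (inner ℂ (r i) a : ℂ) = inner ℂ (r i) b) : a = b :=
  ext_inner_left ℂ fun v => hr.induction_on (p := fun v => (inner ℂ v a : ℂ) = inner ℂ v b) v
    (isClosed_eq (by fun_prop) (by fun_prop)) h

theorem ContinuousLinearMap.ext_of_denseRange {ι G F : Type*} [NormedAddCommGroup G]
    [NormedSpace ℂ G] [NormedAddCommGroup F] [NormedSpace ℂ F] {r : ι → G} (hr : DenseRange r)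
    {A B : G →L[ℂ] F} (h : ∀ i, A (r i) = B (r i)) : A = B :=
  DFunLike.coe_injective (hr.equalizer A.continuous B.continuous (funext h))

theorem ext_kreinInner_of_denseRange {ι G : Type*} [NormedAddCommGroup G] [InnerProductSpace ℂ G]
    [CompleteSpace G] [KreinSpace G] {r : ι → G} (hr : DenseRange r) {a b : G}
    (h : ∀ i, kreinInner a (r i) = kreinInner b (r i)) : a = b := by
  have : (KreinSpace.J a : G) = KreinSpace.J b := ext_inner_of_denseRange hr h
  rw [← KreinSpace.J_J_apply a, this, KreinSpace.J_J_apply]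

end Density

/-! ### The Kreĭn space induced by a selfadjoint operator -/

section InducedKrein

variable {G : Type u} [NormedAddCommGroup G] [InnerProductSpace ℂ G] [CompleteSpace G]

/-- The Kreĭn space induced by a selfadjoint operator `A`: a Kreĭn space with a dense map `r` from
`G` that turns the form of `A` into the indefinite inner product, and to which every pair of
operators intertwined by `A` lifts. -/
theorem exists_induced_kreinSpace {A : G →L[ℂ] G} (hA : IsSelfAdjoint A) :
    ∃ (𝒦 : Type u) (_ : NormedAddCommGroup 𝒦) (_ : InnerProductSpace ℂ 𝒦)
      (_ : CompleteSpace 𝒦) (_ : KreinSpace 𝒦) (r : G →L[ℂ] 𝒦), DenseRange r ∧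
        (∀ f g, kreinInner (r f) (r g) = inner ℂ g (A f)) ∧
        ∀ T S : G →L[ℂ] G, A * T = ContinuousLinearMap.adjoint S * A →
          ∃ U : 𝒦 →L[ℂ] 𝒦, ∀ f, U (r f) = r (T f) := by
  obtain ⟨R, Q, hR, hQ, hRQ, hQR, hsq⟩ := exists_symmetric_factorization hA
  have hR' : ∀ x y, (inner ℂ (R x) y : ℂ) = inner ℂ x (R y) := fun x y => by
    rw [← ContinuousLinearMap.adjoint_inner_right,
      show ContinuousLinearMap.adjoint R = R from hR.star_eq]
  have hQ' : ∀ x y, (inner ℂ (Q x) y : ℂ) = inner ℂ x (Q y) := fun x y => by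
    rw [← ContinuousLinearMap.adjoint_inner_right,
      show ContinuousLinearMap.adjoint Q = Q from hQ.star_eq]
  have hRQ' : ∀ x, R (Q x) = A x := fun x => by rw [← hRQ, mul_apply_eq_comp]
  have hQR' : ∀ x, Q (R x) = A x := fun x => by rw [← hQR, mul_apply_eq_comp]
  have hsq' : ∀ x, Q (Q x) = R (R x) := fun x => by
    rw [← mul_apply_eq_comp, hsq, mul_apply_eq_comp]
  have nQ : ∀ x, ‖Q x‖ = ‖R x‖ := fun x => by
    have h1 : (inner ℂ (Q x) (Q x) : ℂ) = inner ℂ (R x) (R x) := by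
      rw [hQ', hR', hsq']
    rw [← sq_eq_sq₀ (norm_nonneg _) (norm_nonneg _)]
    simpa [inner_self_eq_norm_sq_to_K, ← Complex.ofReal_pow] using h1
  -- `N` is the closure of the range of `R`. Since `‖Q x‖ = ‖R x‖`, the kernels of `R` and `Q`
  -- agree, so `Q` also maps into `N`.
  let N : Submodule ℂ G := R.kerᗮ
  have memR : ∀ x, R x ∈ N := fun x => (Submodule.mem_orthogonal _ _).2 fun y hy => by
    rw [← hR', show R y = 0 from hy, inner_zero_left]
  have memQ : ∀ x, Q x ∈ N := fun x => (Submodule.mem_orthogonal _ _).2 fun y hy => by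
    rw [← hQ', show Q y = 0 from norm_eq_zero.1 (by rw [nQ, show R y = 0 from hy, norm_zero]),
      inner_zero_left]
  let r : G →L[ℂ] N := R.codRestrict N memR
  let s : G →L[ℂ] N := Q.codRestrict N memQ
  have hr : DenseRange r := by
    -- A vector `x ∈ N` orthogonal to `R (R x)` has `R x = 0`, hence is orthogonal to itself.
    have : (LinearMap.range r.toLinearMap)ᗮ = ⊥ := by
      rw [Submodule.eq_bot_iff]
      intro x hx
      have hRx : R x = 0 := by
        rw [← inner_self_eq_zero (𝕜 := ℂ), ← hR']
        exact (Submodule.mem_orthogonal _ _).1 hx (r (R x)) ⟨_, rfl⟩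
      have : (inner ℂ (x : G) (x : G) : ℂ) = 0 := (Submodule.mem_orthogonal _ _).1 x.2 x hRx
      exact Subtype.ext (inner_self_eq_zero.1 this)
    rw [← Submodule.topologicalClosure_eq_top_iff,
      ← Submodule.dense_iff_topologicalClosure_eq_top] at this
    exact this
  -- `J` sends `R f` to `Q f`; this is the sign of `A` on `N`, obtained as an isometric extension.
  let J : N →L[ℂ] N := s.toLinearMap.extendOfNorm r.toLinearMap
  have hJ : ∀ f, J (r f) = s f := fun f =>
    LinearMap.extendOfNorm_eq (f := s.toLinearMap) (e := r.toLinearMap) hr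
      ⟨1, fun x => by rw [one_mul]; exact (nQ x).le⟩ f
  have hJadj : ContinuousLinearMap.adjoint J = J := by
    refine ContinuousLinearMap.ext_of_denseRange hr fun f => ext_inner_of_denseRange hr fun g => ?_
    rw [ContinuousLinearMap.adjoint_inner_right, hJ, hJ]
    change (inner ℂ (Q g) (R f) : ℂ) = inner ℂ (R g) (Q f)
    rw [hQ', hR', hQR', hRQ']
  have hJJ : J ∘L J = ContinuousLinearMap.id ℂ N := by
    refine ContinuousLinearMap.ext_of_denseRange hr fun f => ext_inner_of_denseRange hr fun g => ?_
    rw [ContinuousLinearMap.comp_apply, ← ContinuousLinearMap.adjoint_inner_left, hJadj, hJ, hJ]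
    change (inner ℂ (Q g) (Q f) : ℂ) = inner ℂ (R g) (R f)
    rw [hQ', hR', hsq']
  refine ⟨N, inferInstance, inferInstance, inferInstance, ⟨J, hJadj, hJJ⟩, r, hr, fun f g => ?_,
    fun T S hTS => ?_⟩
  · change (inner ℂ (r g) (J (r f)) : ℂ) = _
    rw [hJ]
    change (inner ℂ (R g) (Q f) : ℂ) = _
    rw [hR', hRQ']
  · obtain ⟨C, hC⟩ := exists_bound_of_intertwining hR hQ hQR hsq hTS
    exact ⟨(r ∘L T).toLinearMap.extendOfNorm r.toLinearMap, fun f =>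
      LinearMap.extendOfNorm_eq (f := (r ∘L T).toLinearMap) (e := r.toLinearMap) hr ⟨C, hC⟩ f⟩

end InducedKrein

/-! ### From a dominating kernel to a Kolmogorov decomposition -/

section Main

variable {S : Type w} [Monoid S] [StarMul S] {X : Type u} [MulAction S X]
variable {H : Type v} [NormedAddCommGroup H] [InnerProductSpace ℂ H] [CompleteSpace H]
  [KreinSpace H]

theorem kreinInner_kreinAdjoint_left {𝒦 : Type*} [NormedAddCommGroup 𝒦] [InnerProductSpace ℂ 𝒦]
    [CompleteSpace 𝒦] [KreinSpace 𝒦] (T : H →L[ℂ] 𝒦) (ζ : 𝒦) (η : H) :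
    kreinInner (kreinAdjoint T ζ) η = kreinInner ζ (T η) := by
  rw [← kreinInner_conj, ← kreinInner_apply_left, kreinInner_conj]

/-- The maps `ξ ↦ q(ξ_x)` into the Hilbert space of a positive definite kernel are bounded. -/
theorem exists_bound_realization_single {G : Type*} [NormedAddCommGroup G] [InnerProductSpace ℂ G]
    {L : X → X → H →L[ℂ] H} {q : (X →₀ H) →ₗ[ℂ] G}
    (hq : ∀ f g, kernelForm L f g = inner ℂ (q g) (q f)) (x : X) :
    ∃ C, ∀ ξ, ‖q (Finsupp.single x ξ)‖ ≤ C * ‖ξ‖ := by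
  refine ⟨√‖(KreinSpace.J ∘L L x x : H →L[ℂ] H)‖, fun ξ => le_of_sq_le_sq ?_ (by positivity)⟩
  rw [mul_pow, Real.sq_sqrt (norm_nonneg _), ← kernelForm_self_re_eq_norm_sq hq, kernelForm_single]
  refine (Complex.re_le_norm _).trans ((norm_inner_le_norm _ _).trans ?_)
  have := (KreinSpace.J ∘L L x x : H →L[ℂ] H).le_opNorm ξ
  rw [ContinuousLinearMap.comp_apply] at this
  nlinarith [norm_nonneg ξ]

/-- A hermitian kernel between `-L` and `L` is given by a selfadjoint operator on the Hilbert space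
of `L`. -/
theorem exists_gram_operator {G : Type*} [NormedAddCommGroup G] [InnerProductSpace ℂ G]
    [CompleteSpace G] {K L : X → X → H →L[ℂ] H} (hK : IsHermitianKernel K)
    (hL : IsPosDefKernel L) (h₁ : KernelLE (-L) K) (h₂ : KernelLE K L)
    {q : (X →₀ H) →ₗ[ℂ] G} (hqd : DenseRange q)
    (hq : ∀ f g, kernelForm L f g = inner ℂ (q g) (q f)) :
    ∃ A : G →L[ℂ] G, IsSelfAdjoint A ∧ ∀ f g, kernelForm K f g = inner ℂ (q g) (A (q f)) := by
  have hM : IsPosDefKernel (K + L) := by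
    refine ⟨isHermitianKernel_iff.2 fun x y ξ η => ?_, fun f => ?_⟩
    · simp only [Pi.add_apply, add_apply, kreinInner_add_left, map_add,
        isHermitianKernel_iff.1 hK x y, isHermitianKernel_iff.1 hL.1 x y]
    · have := h₁ f
      rw [kernelForm_neg, Complex.neg_re] at this
      rw [kernelForm_add, Complex.add_re]
      linarith
  -- Since `0 ≤ K + L ≤ 2L`, the Hilbert space of `K + L` receives a map `T` from that of `L` with
  -- bound `√2`. The form of `K + L` is then that of `T* T`, and subtracting `L` leaves `A = T* T -
  -- 1`.
  obtain ⟨G', _, _, _, q', -, hq'⟩ := hM.exists_realization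
  have hb : ∀ f, ‖q' f‖ ≤ √2 * ‖q f‖ := fun f => by
    refine le_of_sq_le_sq ?_ (by positivity)
    rw [mul_pow, Real.sq_sqrt zero_le_two, ← kernelForm_self_re_eq_norm_sq hq,
      ← kernelForm_self_re_eq_norm_sq hq', kernelForm_add, Complex.add_re]
    linarith [h₂ f]
  have hT := LinearMap.extendOfNorm_eq hqd ⟨_, hb⟩
  set T := q'.extendOfNorm q
  refine ⟨ContinuousLinearMap.adjoint T ∘L T - 1, ?_, fun f g => ?_⟩
  · exact (IsSelfAdjoint.star_eq <| by
      exact (ContinuousLinearMap.isPositive_adjoint_comp_self T).isSelfAdjoint.sub (.one _))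
  · have := hq' f g
    rw [kernelForm_add, hq] at this
    rw [sub_apply, one_apply_eq_self, inner_sub_right, ContinuousLinearMap.comp_apply,
      ContinuousLinearMap.adjoint_inner_right, hT, hT, ← this, add_sub_cancel_right]

theorem exists_kolmogorov_of_dominated {α : S → X → ℂ} (hα : IsMultiplier α)
    (hα_star : ∀ (a : S) (x : X), α (a * star a) x = 1) {K L : X → X → H →L[ℂ] H}
    (hK : IsHermitianKernel K) (hK_inv : IsPhiInvariant α K) (hL : IsPhiBoundedPosDef α L)
    (h₁ : KernelLE (-L) K) (h₂ : KernelLE K L) :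
    ∃ (𝒦 : Type (max u v)) (_ : NormedAddCommGroup 𝒦) (_ : InnerProductSpace ℂ 𝒦)
      (_ : CompleteSpace 𝒦) (_ : KreinSpace 𝒦) (V : X → H →L[ℂ] 𝒦),
      IsKolmogorovDecomposition K V ∧
        ∃ U : S → 𝒦 →L[ℂ] 𝒦, IsSymmProjRep α U ∧
          ∀ (a : S) (x : X), V (a • x) = α a x • (U a ∘L V x) := by
  obtain ⟨G, _, _, _, q, hqd, hq⟩ := hL.1.exists_realization
  obtain ⟨A, hA, hAq⟩ := exists_gram_operator hK hL.1 h₁ h₂ hqd hq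
  obtain ⟨𝒦, i₁, i₂, i₃, i₄, r, hr, hrA, hlift⟩ := exists_induced_kreinSpace hA
  have hshift : ∀ a : S, ∃ T : G →L[ℂ] G, ∀ f, T (q f) = q (kernelShift α a f) := fun a => by
    obtain ⟨C, -, hC⟩ := hL.2 a
    simp only [kernelSeminorm_eq_norm hq] at hC
    exact ⟨(q ∘ₗ kernelShift α a).extendOfNorm q, LinearMap.extendOfNorm_eq hqd ⟨C, hC⟩⟩
  choose T hT using hshift
  have hform : ∀ f g, kreinInner (r (q f)) (r (q g)) = kernelForm K f g := fun f g => by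
    rw [hrA, hAq]
  have hU : ∀ a : S, ∃ U : 𝒦 →L[ℂ] 𝒦, ∀ f, U (r f) = r (T a f) := fun a => by
    -- The scalar is conjugated because it returns through the conjugate-linear slot of the inner
    -- product.
    refine hlift (T a) ((starRingEnd ℂ) (multiplierCocycle α (star a) a) • T (star a)) ?_
    refine ContinuousLinearMap.ext_of_denseRange hqd fun f =>
      ext_inner_of_denseRange hqd fun g => ?_
    rw [mul_apply_eq_comp, mul_apply_eq_comp, ContinuousLinearMap.adjoint_inner_right, smul_apply,
      inner_smul_left, Complex.conj_conj, hT, hT, ← hAq, ← hAq,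
      kernelForm_kernelShift hα hα_star hK hK_inv]
  choose U hU using hU
  have hUw : ∀ a f, U a (r (q f)) = r (q (kernelShift α a f)) := fun a f => by rw [hU, hT]
  have hw : DenseRange fun f => r (q f) := hr.comp hqd r.continuous
  have hV : ∀ x, ∃ V : H →L[ℂ] 𝒦, ∀ ξ, V ξ = r (q (Finsupp.single x ξ)) := fun x => by
    obtain ⟨C, hC⟩ := exists_bound_realization_single hq x
    exact ⟨r ∘L (q ∘ₗ Finsupp.lsingle x).mkContinuous C hC, fun ξ => rfl⟩
  choose V hV using hV
  have hVw : ∀ f, synthesis V f = r (q f) := fun f => by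
    have : synthesis V = r.toLinearMap ∘ₗ q := by
      ext x ξ
      simp [hV]
    rw [this]; rfl
  refine ⟨𝒦, i₁, i₂, i₃, i₄, V, ⟨fun x y => ?_, ?_⟩, U, ⟨fun a b => ?_, fun a => ?_⟩, fun a x => ?_⟩
  · ext ξ
    refine eq_of_kreinInner_right fun η => ?_
    rw [ContinuousLinearMap.comp_apply, kreinInner_kreinAdjoint_left, hV, hV, hform,
      kernelForm_single]
  · rw [dense_span_iff_denseRange_synthesis, show ⇑(synthesis V) = fun f => r (q f) from funext hVw]
    exact hw
  · refine ContinuousLinearMap.ext_of_denseRange hw fun f => ?_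
    rw [ContinuousLinearMap.comp_apply, smul_apply, hUw, hUw, hUw, kernelShift_comp hα, map_smul,
      map_smul]
  · refine ContinuousLinearMap.ext_of_denseRange hw fun f =>
      ext_kreinInner_of_denseRange hw fun g => ?_
    rw [kreinInner_kreinAdjoint_left, smul_apply, kreinInner_smul_left, hUw, hUw, hform, hform,
      ← kernelForm_conj hK (kernelShift α a g) f,
      kernelForm_kernelShift hα hα_star hK hK_inv a g f, map_mul, kernelForm_conj hK]
  · ext ξ
    rw [smul_apply, ContinuousLinearMap.comp_apply, hV, hV, hUw, kernelShift_single, ← map_smul,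
      ← map_smul, Finsupp.smul_single, smul_smul, mul_inv_cancel₀ (hα.ne_zero a x), one_smul]

end Main

/-! ### Disjoint decompositions and domination -/

section Decomposition

variable {X : Type u}
variable {H : Type v} [NormedAddCommGroup H] [InnerProductSpace ℂ H] [CompleteSpace H]
  [KreinSpace H]
variable {G : Type*} [NormedAddCommGroup G] [InnerProductSpace ℂ G] [CompleteSpace G]

/-- The operator is a selfadjoint idempotent `P`, so `P = P* P`. It is used for `J` and for `-J`. -/
theorem isPositive_half_one_add {J : G →L[ℂ] G} (hJ : IsSelfAdjoint J) (hJJ : J * J = 1) :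
    ((2⁻¹ : ℂ) • (1 + J)).IsPositive := by
  have hP : IsSelfAdjoint ((2⁻¹ : ℂ) • (1 + J)) := by
    rw [isSelfAdjoint_iff, star_smul, star_add, star_one, hJ.star_eq]
    simp
  have h : (2⁻¹ : ℂ) • (1 + J) = ContinuousLinearMap.adjoint ((2⁻¹ : ℂ) • (1 + J)) ∘L
      ((2⁻¹ : ℂ) • (1 + J)) := by
    rw [← ContinuousLinearMap.star_eq_adjoint, hP.star_eq]
    change _ = ((2⁻¹ : ℂ) • (1 + J)) * ((2⁻¹ : ℂ) • (1 + J))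
    rw [smul_mul_smul_comm, add_mul, mul_add, mul_add, hJJ, one_mul, one_mul, mul_one]
    module
  rw [h]
  exact ContinuousLinearMap.isPositive_adjoint_comp_self _

/-- Positive operators with product zero give disjoint kernels when their sum is the identity. -/
theorem disjointKernels_operatorKernel {V : X → H →L[ℂ] G} (hV : DenseRange (synthesis V))
    {B C : G →L[ℂ] G} (hsum : B + C = 1) (hBC : B * C = 0) (hCB : C * B = 0) :
    DisjointKernels (operatorKernel V B) (operatorKernel V C) := by
  intro P hP hPB hPC
  obtain ⟨G', _, _, _, q, -, hq⟩ := hP.exists_realization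
  have hbound : ∀ {D : G →L[ℂ] G}, KernelLE P (operatorKernel V D) → ∀ f,
      ‖q f‖ ^ 2 ≤ (inner ℂ (synthesis V f) (D (synthesis V f)) : ℂ).re := fun {D} h f => by
    rw [← kernelForm_self_re_eq_norm_sq hq, ← kernelForm_operatorKernel]
    exact h f
  have hb : ∀ f, ‖q f‖ ≤ √‖B‖ * ‖synthesis V f‖ := fun f => by
    refine le_of_sq_le_sq ((hbound hPB f).trans ?_) (by positivity)
    rw [mul_pow, Real.sq_sqrt (norm_nonneg _)]
    refine (Complex.re_le_norm _).trans ((norm_inner_le_norm _ _).trans ?_)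
    nlinarith [B.le_opNorm (synthesis V f), norm_nonneg (synthesis V f)]
  have hT := LinearMap.extendOfNorm_eq hV ⟨_, hb⟩
  set T := q.extendOfNorm (synthesis V)
  have hTle : ∀ {D : G →L[ℂ] G}, KernelLE P (operatorKernel V D) → ∀ v,
      ‖T v‖ ^ 2 ≤ (inner ℂ v (D v) : ℂ).re := fun {D} h v =>
    hV.induction_on (p := fun v => ‖T v‖ ^ 2 ≤ (inner ℂ v (D v) : ℂ).re) v
      (isClosed_le (by fun_prop) (by fun_prop)) fun f => by rw [hT]; exact hbound h f
  -- The bound by `C`, tested on the range of `B`, gives zero because `C * B = 0`; the roles are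
  -- then exchanged.
  have hTB : ∀ v, T (B v) = 0 := fun v => by
    have := hTle hPC (B v)
    rw [← mul_apply_eq_comp C B, hCB, zero_apply, inner_zero_right, Complex.zero_re] at this
    exact norm_eq_zero.1 (pow_eq_zero_iff two_ne_zero |>.1 (le_antisymm this (sq_nonneg _)))
  have hTC : ∀ v, T (C v) = 0 := fun v => by
    have := hTle hPB (C v)
    rw [← mul_apply_eq_comp B C, hBC, zero_apply, inner_zero_right, Complex.zero_re] at this
    exact norm_eq_zero.1 (pow_eq_zero_iff two_ne_zero |>.1 (le_antisymm this (sq_nonneg _)))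
  have hT0 : ∀ v, T v = 0 := fun v => by
    have : v = B v + C v := by rw [← add_apply, hsum, one_apply_eq_self]
    rw [this, map_add, hTB, hTC, add_zero]
  refine kernel_ext fun x y ξ η => ?_
  rw [← kernelForm_single, hq, ← hT, hT0, inner_zero_left]
  simp [kreinInner_zero_left]

theorem operatorKernel_add (V : X → H →L[ℂ] G) (B C : G →L[ℂ] G) :
    operatorKernel V (B + C) = operatorKernel V B + operatorKernel V C :=
  kernel_ext fun x y ξ η => by
    simp only [Pi.add_apply, add_apply, kreinInner_add_left, kreinInner_operatorKernel,
      inner_add_right]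

theorem operatorKernel_sub (V : X → H →L[ℂ] G) (B C : G →L[ℂ] G) :
    operatorKernel V (B - C) = operatorKernel V B - operatorKernel V C :=
  kernel_ext fun x y ξ η => by
    simp only [Pi.sub_apply, sub_apply, kreinInner_sub_left, kreinInner_operatorKernel,
      inner_sub_right]

/-- The seminorm of this kernel is `‖synthesis V f‖`, and `synthesis V` intertwines `ψ_a` with `U
a`, so `‖U a‖` is a bound. -/
theorem isPhiBoundedPosDef_operatorKernel_one {S : Type w} [Monoid S] [MulAction S X]
    {α : S → X → ℂ} (hα : IsMultiplier α) {V : X → H →L[ℂ] G} {U : S → G →L[ℂ] G}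
    (hUV : ∀ (a : S) (x : X), V (a • x) = α a x • (U a ∘L V x)) :
    IsPhiBoundedPosDef α (operatorKernel V 1) := by
  refine ⟨isPosDefKernel_operatorKernel V ContinuousLinearMap.isPositive_one,
    fun a => ⟨‖U a‖, norm_nonneg _, fun f => ?_⟩⟩
  have hq : ∀ f g, kernelForm (operatorKernel V 1) f g =
      inner ℂ (synthesis V g) (synthesis V f) := fun f g => by
    rw [kernelForm_operatorKernel, one_apply_eq_self]
  have hshift : synthesis V (kernelShift α a f) = U a (synthesis V f) := by
    induction f using Finsupp.induction_linear with
    | zero => simp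
    | add f g hf hg => simp only [map_add, hf, hg]
    | single x ξ =>
      rw [kernelShift_single, synthesis_single, synthesis_single, hUV, smul_apply, map_smul,
        smul_smul, mul_inv_cancel₀ (hα.ne_zero a x), one_smul, ContinuousLinearMap.comp_apply]
  rw [kernelSeminorm_eq_norm hq, kernelSeminorm_eq_norm hq, hshift]
  exact (U a).le_opNorm _

theorem exists_disjoint_decomposition {S : Type w} [Monoid S] [MulAction S X]
    [KreinSpace G] {α : S → X → ℂ} (hα : IsMultiplier α) {K : X → X → H →L[ℂ] H}
    {V : X → H →L[ℂ] G} (hV : IsKolmogorovDecomposition K V) {U : S → G →L[ℂ] G}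
    (hUV : ∀ (a : S) (x : X), V (a • x) = α a x • (U a ∘L V x)) :
    ∃ K₁ K₂ : X → X → H →L[ℂ] H, IsPosDefKernel K₁ ∧ IsPosDefKernel K₂ ∧
      DisjointKernels K₁ K₂ ∧ K = K₁ - K₂ ∧ IsPhiBoundedPosDef α (K₁ + K₂) := by
  set J : G →L[ℂ] G := KreinSpace.J
  have hJ : IsSelfAdjoint J := KreinSpace.adjoint_J
  have hJJ : J * J = 1 := KreinSpace.J_comp_J
  -- By definition `V(x)♯` is `J V(x)* J`, whose inner factor is the symmetry of `G`.
  have hKJ : K = operatorKernel V J := by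
    funext x y
    exact hV.1 x y
  have hsum : (2⁻¹ : ℂ) • (1 + J) + (2⁻¹ : ℂ) • (1 + -J) = 1 := by module
  refine ⟨operatorKernel V ((2⁻¹ : ℂ) • (1 + J)), operatorKernel V ((2⁻¹ : ℂ) • (1 + -J)),
    isPosDefKernel_operatorKernel V (isPositive_half_one_add hJ hJJ),
    isPosDefKernel_operatorKernel V (isPositive_half_one_add hJ.neg (by rw [neg_mul_neg, hJJ])),
    disjointKernels_operatorKernel ((dense_span_iff_denseRange_synthesis V).1 hV.2) hsum ?_ ?_,
    ?_, ?_⟩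
  · rw [smul_mul_smul_comm]
    simp [add_mul, mul_add, hJJ]
    abel
  · rw [smul_mul_smul_comm]
    simp [add_mul, mul_add, hJJ]
  · rw [hKJ, ← operatorKernel_sub]
    congr 1
    module
  · rw [← operatorKernel_add, hsum]
    exact isPhiBoundedPosDef_operatorKernel_one hα hUV

theorem kernelLE_add_of_eq_sub {K K₁ K₂ : X → X → H →L[ℂ] H} (h₁ : IsPosDefKernel K₁)
    (h₂ : IsPosDefKernel K₂) (hK : K = K₁ - K₂) :
    KernelLE (-(K₁ + K₂)) K ∧ KernelLE K (K₁ + K₂) := by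
  rw [sub_eq_add_neg] at hK
  subst hK
  refine ⟨fun f => ?_, fun f => ?_⟩ <;>
  · have := h₁.2 f
    have := h₂.2 f
    simp only [kernelForm_neg, kernelForm_add, Complex.add_re, Complex.neg_re]
    linarith

end Decomposition

/-- The universe `max u v` is that of `X →₀ H`, hence of its completion and of the closed subspace
used as the Kreĭn space. -/
theorem mainTheorem1 {S : Type w} [Monoid S] [StarMul S] {X : Type u} [MulAction S X]
    {H : Type v} [NormedAddCommGroup H] [InnerProductSpace ℂ H] [CompleteSpace H] [KreinSpace H]
    (α : S → X → ℂ) (hα : IsMultiplier α) (hα_star : ∀ (a : S) (x : X), α (a * star a) x = 1)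
    (K : X → X → H →L[ℂ] H) (hK : IsHermitianKernel K) (hK_inv : IsPhiInvariant α K) :
    List.TFAE [
      ∃ L : X → X → H →L[ℂ] H, IsPhiBoundedPosDef α L ∧ KernelLE (-L) K ∧ KernelLE K L,
      ∃ (𝒦 : Type (max u v)) (_ : NormedAddCommGroup 𝒦) (_ : InnerProductSpace ℂ 𝒦)
        (_ : CompleteSpace 𝒦) (_ : KreinSpace 𝒦) (V : X → H →L[ℂ] 𝒦),
        IsKolmogorovDecomposition K V ∧
          ∃ U : S → 𝒦 →L[ℂ] 𝒦, IsSymmProjRep α U ∧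
            ∀ (a : S) (x : X), V (a • x) = α a x • (U a ∘L V x),
      ∃ K₁ K₂ : X → X → H →L[ℂ] H, IsPosDefKernel K₁ ∧ IsPosDefKernel K₂ ∧ K = K₁ - K₂ ∧
        IsPhiBoundedPosDef α (K₁ + K₂),
      ∃ K₁ K₂ : X → X → H →L[ℂ] H, IsPosDefKernel K₁ ∧ IsPosDefKernel K₂ ∧
        DisjointKernels K₁ K₂ ∧ K = K₁ - K₂ ∧ IsPhiBoundedPosDef α (K₁ + K₂)] := by
  tfae_have 1 → 2 := fun ⟨_, hL, h₁, h₂⟩ =>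
    exists_kolmogorov_of_dominated hα hα_star hK hK_inv hL h₁ h₂
  tfae_have 2 → 4 := fun ⟨_, _, _, _, _, _, hV, _, _, hUV⟩ =>
    exists_disjoint_decomposition hα hV hUV
  tfae_have 4 → 3 := fun ⟨K₁, K₂, h₁, h₂, _, hK, hb⟩ => ⟨K₁, K₂, h₁, h₂, hK, hb⟩
  tfae_have 3 → 1 := fun ⟨K₁, K₂, h₁, h₂, hK, hb⟩ =>
    ⟨K₁ + K₂, hb, kernelLE_add_of_eq_sub h₁ h₂ hK⟩
  tfae_finish
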